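/- Let $\alpha>-\tfrac12$ be real. Equip the space $H(\mathbb C)$ of entire functions with the topology of uniform convergence on compact sets, and let $\Lambda_\alpha:H(\mathbb C)\to H(\mathbb C)$ be the Dunkl operator $$\Lambda_\alpha f(z)=f'(z)+\frac{2\alpha+1}{z}\cdot\frac{f(z)-f(-z)}{2},$$ where the right-hand side is extended to $z=0$ by its limit $(2\alpha+2)f'(0)$. An entire function $f$ is called frequently hypercyclic for $\Lambda_\alpha$ if for every non-empty open set $U\subset H(\mathbb C)$ the set $\{n\in\mathbb N:\Lambda_\alpha^n f\in U\}$ has positive lower density, where the lower density of $A\subset\mathbb N=\{1,2,\dots\}$ is $\liminf_{N\to\infty}\#\{n\in A:n\le N\}/N$. For $r>0$ put $$M_p(f,r)=\Big(\frac1{2\pi}\int_0^{2\pi}|f(re^{it})|^p\,dt\Big)^{1/p}\quad(1\le p<\infty),\qquad M_\infty(f,r)=\sup_{|z|=r}|f(z)|.$$ Theorem. Let $1\le p\le\infty$ and put $a=\alpha+\frac12+\frac1{2\max\{2,p\}}$, where $\frac{1}{2\max\{2,p\}}=0$ if $p=\infty$. Then for every function $\varphi:(0,\infty)\to(0,\infty)$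 with $\varphi(r)\to\infty$ as $r\to\infty$ there is an entire function $f$ that is frequently hypercyclic for $\Lambda_\alpha$ and satisfies $$M_p(f,r)\le\varphi(r)\,\frac{e^r}{r^a}\qquad\text{for all sufficiently large } r>0.$$ -/

import Mathlib

open Filter Topology
open scoped ENNReal

noncomputable section

/-- The space `H(ℂ)` of entire functions. As a subspace of `C(ℂ, ℂ)` it carries the compact-open
topology, that is, the topology of uniform convergence on compact subsets of `ℂ`. -/
def EntireFunctions : Submodule ℂ C(ℂ, ℂ) where
  carrier := {f | Differentiable ℂ f}
  zero_mem' := differentiable_const (0 : ℂ)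
  add_mem' := fun hf hg => Differentiable.add hf hg
  smul_mem' := fun c _ hf => Differentiable.const_smul hf c

/-- The formula `f'(z) + (2α+1)/z * (f(z) - f(-z))/2`, with the removable singularity
at `0` filled in by its limit `(2α+2) f'(0)`. -/
def dunklFun (α : ℝ) (f : ℂ → ℂ) (z : ℂ) : ℂ :=
  if z = 0 then (2 * α + 2) * deriv f 0
  else deriv f z + (2 * α + 1) / z * ((f z - f (-z)) / 2)

theorem differentiable_dunklFun (α : ℝ) {f : ℂ → ℂ} (hf : Differentiable ℂ f) :
    Differentiable ℂ (dunklFun α f) := by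
  have hn : Differentiable ℂ (fun w : ℂ => f (-w)) := hf.comp differentiable_neg
  have hg : Differentiable ℂ (fun w : ℂ => (f w - f (-w)) / 2) := (hf.sub hn).div_const 2
  have hd : Differentiable ℂ (deriv f) :=
    (hf.contDiff (n := 2)).differentiable_deriv_two
  have hs : Differentiable ℂ (dslope (fun w : ℂ => (f w - f (-w)) / 2) 0) := by
    rw [← differentiableOn_univ] at hg ⊢
    exact (Complex.differentiableOn_dslope univ_mem).2 hg
  have hg0 : deriv (fun w : ℂ => (f w - f (-w)) / 2) 0 = deriv f 0 := by
    rw [deriv_div_const, deriv_fun_sub (hf 0) (hn 0), deriv_comp_neg]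
    simp
  have he : dunklFun α f = fun z => deriv f z +
      (2 * α + 1) * dslope (fun w : ℂ => (f w - f (-w)) / 2) 0 z := by
    funext z
    by_cases hz : z = 0
    · subst hz
      simp only [dunklFun, if_true, dslope_same, hg0]
      ring
    · simp only [dunklFun, if_neg hz, dslope_of_ne _ hz, slope_def_field]
      simp
      ring
  rw [he]
  exact hd.add (hs.const_mul _)

/-- The Dunkl operator `Λ_α` on the space of entire functions. -/
def dunkl (α : ℝ) (f : EntireFunctions) : EntireFunctions :=
  ⟨⟨dunklFun α f.1, (differentiable_dunklFun α f.2).continuous⟩, differentiable_dunklFun α f.2⟩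

/-- The lower density `liminf_{N → ∞} #{n ∈ A : 1 ≤ n ≤ N} / N` of a set of positive integers. -/
def lowerDensity (A : Set ℕ) : ℝ :=
  liminf (fun N : ℕ => ((A ∩ Set.Icc 1 N).ncard : ℝ) / (N : ℝ)) atTop

/-- `x` is frequently hypercyclic for `T`: the orbit of `x` visits every non-empty open set
along a set of times of positive lower density. -/
def IsFrequentlyHypercyclicVector {X : Type*} [TopologicalSpace X] (T : X → X) (x : X) : Prop :=
  ∀ U : Set X, IsOpen U → U.Nonempty → 0 < lowerDensity {n : ℕ | T^[n] x ∈ U}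

/-- The `p`-integral means `M_p(f, r)` on the circle of radius `r`, with `M_∞` the supremum. -/
def integralMean (p : ℝ≥0∞) (f : ℂ → ℂ) (r : ℝ) : ℝ :=
  if p = ∞ then ⨆ z : Metric.sphere (0 : ℂ) r, ‖f z‖
  else (1 / (2 * Real.pi) * ∫ t in (0 : ℝ)..(2 * Real.pi),
    ‖f (r * Complex.exp (t * Complex.I))‖ ^ p.toReal) ^ (1 / p.toReal)

end

/-!
Write `d n` for `dunklFactorial α n`. The Dunkl operator sends `z ^ n / d n` to
`z ^ (n - 1) / d (n - 1)`, so on series `∑ a n z ^ n / d n` it is the backward shift of the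
coefficient sequence (`hasSum_dunklFun`). Two things are asked of the coefficients: that every
finite pattern is approximately visible along a set of positions of positive lower density, and
that `a n` grows very slowly.

*Frequent recurrence.* The `i`-th block of the sequence carries the word whose index is the `2`-adic
valuation of `i`. Each index then has positive frequency among the blocks. A word of index `v` has
length at most `v + 1` and letters of size at most `v`; since the valuations of `1, …, i` sum to at
most `i`, the blocks can be kept apart by gaps exceeding the valuations of both neighbours and still
start at positions at most `3 i`. A block with large letters is therefore far from any other block,
so that, seen from the start of any block, the sequence beyond that block grows at most linearly
(`norm_blockCoeff_le`). The corresponding part of the shifted series is a tail of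
`∑ j R ^ j / d j`, hence negligible when `v` is large
(`isFrequentlyHypercyclicVector_of_blockCoeff`).

*Growth.* A word may be suppressed at all positions in a bounded range without affecting lower
densities. This allows the condition `‖a n‖ ≤ φ r / (2 K)` whenever `n ≤ r ^ 2`, and `‖a n‖ ≤ n`
throughout. The degrees above `r ^ 2` then contribute `O(1)`, and what remains is `φ r` times the
series with constant coefficients (`exists_dunkl_series_growth`). As `d n` is at least a multiple of
`n! (n + 1) ^ (α + 1/2)`, the maximum of that series on `|z| = r` is at most a multiple of
`exp r / r ^ (α + 1/2)`. For the quadratic mean, `(2n)! / n! ^ 2 ≤ 4 ^ n / √(2n + 1)` turns the sum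
of squares into an exponential sum at `2r`, which saves a further factor `r ^ (-1/4)`. The means of
order `p < 2` are controlled by the quadratic mean, and those of order `p > 2` by interpolation
between the quadratic mean and the maximum; this gives the exponent `1 / (2 max {2, p})`.
-/

/-! ### Weights of the Dunkl operator -/

/-- The Dunkl analogue of the factorial: `Λ_α` sends `z ^ n / dunklFactorial α n` to
`z ^ (n - 1) / dunklFactorial α (n - 1)`, because
`Λ_α z ^ n = (n + (2α + 1) [n odd]) z ^ (n - 1)`. -/
noncomputable def dunklFactorial (α : ℝ) : ℕ → ℝ
  | 0 => 1
  | n + 1 => (n + 1 + if Even n then 2 * α + 1 else 0) * dunklFactorial α n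

theorem factorial_le_dunklFactorial {α : ℝ} (hα : -(1 / 2) < α) (n : ℕ) :
    (n.factorial : ℝ) ≤ dunklFactorial α n := by
  induction n with
  | zero => simp [dunklFactorial]
  | succ n ih =>
    rw [dunklFactorial, Nat.factorial_succ]
    push_cast
    refine mul_le_mul ?_ ih (by positivity) ?_ <;> split_ifs <;> linarith

theorem dunklFactorial_pos {α : ℝ} (hα : -(1 / 2) < α) (n : ℕ) : 0 < dunklFactorial α n :=
  lt_of_lt_of_le (by positivity) (factorial_le_dunklFactorial hα n)

/-- This is `(1 + 1 / (x + b)) ^ b ≤ exp (b / (x + b)) ≤ (x + b) / x`. Unlike the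
Bernoulli bound `(1 + 1 / x) ^ b ≤ 1 + b / x`, it needs no restriction to `b ≤ 1`. -/
theorem rpow_add_one_le {x b : ℝ} (hx : 0 < x) (hb : 0 < b) :
    (x + b + 1) ^ b ≤ (x + b) ^ b * (1 + b / x) := by
  have hxb : 0 < x + b := by positivity
  have h1 : (x + b + 1) = (x + b) * (1 + 1 / (x + b)) := by field_simp
  rw [h1, Real.mul_rpow hxb.le (by positivity)]
  refine mul_le_mul_of_nonneg_left ?_ (by positivity)
  have h2 : 1 + 1 / (x + b) ≤ Real.exp (1 / (x + b)) := by
    linarith [Real.add_one_le_exp (1 / (x + b))]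
  have h3 : (1 + 1 / (x + b)) ^ b ≤ Real.exp (b / (x + b)) := by
    calc (1 + 1 / (x + b)) ^ b ≤ (Real.exp (1 / (x + b))) ^ b :=
          Real.rpow_le_rpow (by positivity) h2 hb.le
      _ = Real.exp (b / (x + b)) := by rw [← Real.exp_mul]; congr 1; ring
  have h4 : x / (x + b) ≤ Real.exp (-(b / (x + b))) := by
    have := Real.add_one_le_exp (-(b / (x + b)))
    have h5 : x / (x + b) = -(b / (x + b)) + 1 := by field_simp; ring
    linarith
  rw [Real.exp_neg] at h4
  have h6 : Real.exp (b / (x + b)) ≤ (x / (x + b))⁻¹ := by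
    rw [← inv_inv (Real.exp (b / (x + b)))]
    exact inv_anti₀ (by positivity) h4
  refine h3.trans (h6.trans (le_of_eq ?_))
  field_simp

/-- The growth in pairs of steps: over two steps the ratio `dunklFactorial α n / n!` is multiplied
by `1 + (2α + 1) / (n + 1)`, which `rpow_add_one_le` compares with the growth of a power. -/
theorem dunklFactorial_two_mul_ge {α : ℝ} (hα : -(1 / 2) < α) (m : ℕ) :
    (1 / 2 + (α + 1 / 2)) ^ (-(α + 1 / 2)) *
      ((2 * m).factorial * (m + 1 / 2 + (α + 1 / 2)) ^ (α + 1 / 2)) ≤ dunklFactorial α (2 * m) := by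
  have hb : 0 < α + 1 / 2 := by linarith
  set b := α + 1 / 2 with hbdef
  induction m with
  | zero =>
    simp only [Nat.cast_zero, mul_zero, Nat.factorial_zero, Nat.cast_one, zero_add, one_mul,
      dunklFactorial]
    rw [← Real.rpow_add (by positivity)]
    simp
  | succ m ih =>
    have hK : 0 < (1 / 2 + b) ^ (-b) := by positivity
    have h1 := rpow_add_one_le (x := m + 1 / 2) (b := b) (by positivity) hb
    have h2 : dunklFactorial α (2 * (m + 1)) =
        ((2 * m).factorial : ℝ)⁻¹ * (2 * (m + 1)).factorial * (1 + b / (m + 1 / 2)) *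
          dunklFactorial α (2 * m) := by
      have e1 : 2 * (m + 1) = (2 * m + 1) + 1 := by ring
      rw [e1, dunklFactorial, dunklFactorial, Nat.factorial_succ, Nat.factorial_succ,
        if_neg (by simp), if_pos (by simp)]
      have : α = b - 1 / 2 := by rw [hbdef]; ring
      rw [this]
      push_cast
      have := Nat.factorial_ne_zero (2 * m)
      field_simp
      ring
    rw [h2]
    have e2 : (((m + 1 : ℕ) : ℝ) + 1 / 2 + b) = m + 1 / 2 + b + 1 := by push_cast; ring
    rw [e2]
    calc (1 / 2 + b) ^ (-b) * ((2 * (m + 1)).factorial * (m + 1 / 2 + b + 1) ^ b)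
        ≤ (1 / 2 + b) ^ (-b) * ((2 * (m + 1)).factorial *
            ((m + 1 / 2 + b) ^ b * (1 + b / (m + 1 / 2)))) := by gcongr
      _ = ((2 * m).factorial : ℝ)⁻¹ * (2 * (m + 1)).factorial * (1 + b / (m + 1 / 2)) *
          ((1 / 2 + b) ^ (-b) * ((2 * m).factorial * (m + 1 / 2 + b) ^ b)) := by
        have := Nat.factorial_ne_zero (2 * m)
        field_simp
      _ ≤ _ := by gcongr

theorem exists_dunklFactorial_ge {α : ℝ} (hα : -(1 / 2) < α) :
    ∃ c : ℝ, 0 < c ∧ ∀ n : ℕ,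
      c * (n.factorial * ((n : ℝ) + 1) ^ (α + 1 / 2)) ≤ dunklFactorial α n := by
  have hb : 0 < α + 1 / 2 := by linarith
  have key := dunklFactorial_two_mul_ge hα
  set b := α + 1 / 2 with hbdef
  have hK : 0 < (1 / 2 + b) ^ (-b) := by positivity
  refine ⟨(1 / 2 + b) ^ (-b) * (1 / 2) ^ b, by positivity, fun n => ?_⟩
  rw [mul_assoc, mul_left_comm ((1 / 2 : ℝ) ^ b), ← Real.mul_rpow (by norm_num) (by positivity)]
  rcases Nat.even_or_odd' n with ⟨m, rfl | rfl⟩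
  · refine le_trans ?_ (key m)
    gcongr
    push_cast
    linarith
  · have e : (1 / 2 * (((2 * m + 1 : ℕ) : ℝ) + 1)) = (m : ℝ) + 1 := by push_cast; ring
    have h1 : ((m : ℝ) + 1) ^ b ≤ (m + 1 / 2 + b) ^ b * (1 + b / (m + 1 / 2)) :=
      (Real.rpow_le_rpow (by positivity) (by linarith) hb.le).trans
        (rpow_add_one_le (x := m + 1 / 2) (by positivity) hb)
    have h2 : dunklFactorial α (2 * m + 1) =
        (2 * m + 1) * (1 + b / (m + 1 / 2)) * dunklFactorial α (2 * m) := by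
      rw [dunklFactorial, if_pos (by simp)]
      have : α = b - 1 / 2 := by rw [hbdef]; ring
      rw [this]
      push_cast
      field_simp
      ring
    rw [e, h2, Nat.factorial_succ]
    push_cast
    calc (1 / 2 + b) ^ (-b) * ((2 * m + 1) * (2 * m).factorial * ((m : ℝ) + 1) ^ b)
        ≤ (1 / 2 + b) ^ (-b) * ((2 * m + 1) * (2 * m).factorial *
            ((m + 1 / 2 + b) ^ b * (1 + b / (m + 1 / 2)))) := by gcongr
      _ = (2 * m + 1) * (1 + b / (m + 1 / 2)) *
          ((1 / 2 + b) ^ (-b) * ((2 * m).factorial * (m + 1 / 2 + b) ^ b)) := by ring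
      _ ≤ _ := mul_le_mul_of_nonneg_left (key m) (by positivity)

/-! ### Exponential sums with power weights -/

/-- The power `((n + 1) / r) ^ (-b)` is dominated by `1 + (r / (n + 1)) ^ k` for an integer
`k ≥ b`, and `(n + 1) ^ (-k)` turns `1 / n!` into a multiple of `1 / (n + k)!`, so that both
resulting sums are exponential series. -/
theorem exists_tsum_rpow_le {b : ℝ} (hb : 0 < b) :
    ∃ C : ℝ, 0 < C ∧ ∀ r : ℝ, 0 < r →
      Summable (fun n : ℕ => r ^ n / (n.factorial * ((n : ℝ) + 1) ^ b)) ∧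
      ∑' n : ℕ, r ^ n / (n.factorial * ((n : ℝ) + 1) ^ b) ≤ C * (Real.exp r / r ^ b) := by
  obtain ⟨k, hk⟩ := exists_nat_ge b
  refine ⟨1 + (k + 1) ^ k, by positivity, fun r hr => ?_⟩
  have hs : Summable (fun n : ℕ => r ^ n / (n.factorial : ℝ)) := Real.summable_pow_div_factorial r
  have hs' : Summable (fun n : ℕ => r ^ (n + k) / ((n + k).factorial : ℝ)) :=
    (summable_nat_add_iff k).2 hs
  have hexp : ∑' n : ℕ, r ^ n / (n.factorial : ℝ) = Real.exp r := by
    rw [Real.exp_eq_exp_ℝ, NormedSpace.exp_eq_tsum_div]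
  have hexp' : ∑' n : ℕ, r ^ (n + k) / ((n + k).factorial : ℝ) ≤ Real.exp r := by
    rw [← hexp, ← hs.sum_add_tsum_nat_add k]
    exact le_add_of_nonneg_left (Finset.sum_nonneg fun i _ => by positivity)
  have hpt : ∀ n : ℕ, r ^ n / (n.factorial * ((n : ℝ) + 1) ^ b) ≤
      (r ^ n / n.factorial + (k + 1) ^ k * (r ^ (n + k) / (n + k).factorial)) / r ^ b := by
    intro n
    have hn : (0 : ℝ) < n + 1 := by positivity
    have h1 : (r / (n + 1)) ^ b ≤ 1 + (r / (n + 1)) ^ k := by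
      rcases le_total (r / ((n : ℝ) + 1)) 1 with h | h
      · exact (Real.rpow_le_one (by positivity) h hb.le).trans
          (le_add_of_nonneg_right (by positivity))
      · rw [← Real.rpow_natCast]
        exact (Real.rpow_le_rpow_of_exponent_le h hk).trans (by linarith)
    have h2 : ((n + k).factorial : ℝ) ≤ n.factorial * ((k + 1) ^ k * ((n : ℝ) + 1) ^ k) := by
      have : (n + k).factorial ≤ n.factorial * ((k + 1) ^ k * (n + 1) ^ k) := by
        rw [← Nat.factorial_mul_ascFactorial, ← mul_pow]
        refine Nat.mul_le_mul_left _ ((Nat.ascFactorial_le_pow_add n k).trans ?_)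
        exact Nat.pow_le_pow_left (by nlinarith) k
      exact_mod_cast this
    have h3 : r ^ n / n.factorial * (r / (n + 1)) ^ k ≤
        (k + 1) ^ k * (r ^ (n + k) / (n + k).factorial) := by
      rw [div_pow, div_mul_div_comm, ← pow_add, ← mul_div_assoc, div_le_div_iff₀ (by positivity)
        (by positivity)]
      calc r ^ (n + k) * (n + k).factorial
          ≤ r ^ (n + k) * (n.factorial * ((k + 1) ^ k * ((n : ℝ) + 1) ^ k)) := by gcongr
        _ = _ := by ring
    have h4 : r ^ n / (n.factorial * ((n : ℝ) + 1) ^ b) =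
        r ^ n / n.factorial * (r / (n + 1)) ^ b / r ^ b := by
      rw [Real.div_rpow hr.le hn.le]
      have := (Real.rpow_pos_of_pos hn b).ne'
      have := (Real.rpow_pos_of_pos hr b).ne'
      field_simp
    rw [h4]
    gcongr
    calc r ^ n / n.factorial * (r / (n + 1)) ^ b
        ≤ r ^ n / n.factorial * (1 + (r / (n + 1)) ^ k) := by gcongr
      _ = r ^ n / n.factorial + r ^ n / n.factorial * (r / (n + 1)) ^ k := by ring
      _ ≤ _ := by gcongr
  have hsum : Summable (fun n : ℕ =>
      (r ^ n / n.factorial + (k + 1) ^ k * (r ^ (n + k) / (n + k).factorial)) / r ^ b) :=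
    (hs.add (hs'.mul_left _)).div_const _
  have hS := hsum.of_nonneg_of_le (fun n => by positivity) hpt
  refine ⟨hS, (hS.tsum_le_tsum hpt hsum).trans ?_⟩
  rw [tsum_div_const, hs.tsum_add (hs'.mul_left _), tsum_mul_left, hexp, ← mul_div_assoc]
  gcongr
  nlinarith [pow_pos (by positivity : (0 : ℝ) < k + 1) k]

theorem centralBinom_sq_le (n : ℕ) : n.centralBinom ^ 2 * (2 * n + 1) ≤ 16 ^ n := by
  induction n with
  | zero => simp
  | succ n ih =>
    have h := Nat.succ_mul_centralBinom_succ n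
    refine Nat.le_of_mul_le_mul_left (c := (n + 1) ^ 2) ?_ (by positivity)
    calc (n + 1) ^ 2 * ((n + 1).centralBinom ^ 2 * (2 * (n + 1) + 1))
        = ((n + 1) * (n + 1).centralBinom) ^ 2 * (2 * n + 3) := by ring
      _ = (n.centralBinom ^ 2 * (2 * n + 1)) * (4 * ((2 * n + 1) * (2 * n + 3))) := by
        rw [h]; ring
      _ ≤ 16 ^ n * (4 * ((2 * n + 1) * (2 * n + 3))) := Nat.mul_le_mul_right _ ih
      _ ≤ 16 ^ n * (16 * (n + 1) ^ 2) := Nat.mul_le_mul_left _ (by nlinarith)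
      _ = (n + 1) ^ 2 * 16 ^ (n + 1) := by ring

/-- Since `(2n)! / n! ^ 2 ≤ 4 ^ n / √(2n + 1)`, the sum is dominated by the even part of the
exponential sum at `2r` with weight exponent `2b + 1/2`. -/
theorem exists_tsum_sq_rpow_le {b : ℝ} (hb : 0 < b) :
    ∃ C : ℝ, 0 < C ∧ ∀ r : ℝ, 0 < r →
      Summable (fun n : ℕ => (r ^ n / (n.factorial * ((n : ℝ) + 1) ^ b)) ^ 2) ∧
      ∑' n : ℕ, (r ^ n / (n.factorial * ((n : ℝ) + 1) ^ b)) ^ 2 ≤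
        C * ((Real.exp r / r ^ b) ^ 2 / r ^ (1 / 2 : ℝ)) := by
  obtain ⟨C, hC, hmain⟩ := exists_tsum_rpow_le (b := 2 * b + 1 / 2) (by positivity)
  refine ⟨2 ^ (2 * b) * C, by positivity, fun r hr => ?_⟩
  obtain ⟨hs, hle⟩ := hmain (2 * r) (by positivity)
  set F : ℕ → ℝ := fun n => (2 * r) ^ n / (n.factorial * ((n : ℝ) + 1) ^ (2 * b + 1 / 2)) with hF
  have hF0 : ∀ n, 0 ≤ F n := fun n => by positivity
  have hinj : Function.Injective (fun n : ℕ => 2 * n) := fun x y h => by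
    simpa using h
  have hs2 : Summable (fun n : ℕ => F (2 * n)) := hs.comp_injective hinj
  have hle2 : ∑' n : ℕ, F (2 * n) ≤ ∑' n, F n :=
    hs2.tsum_le_tsum_of_inj (fun n : ℕ => 2 * n) hinj (fun c _ => hF0 c) (fun _ => le_rfl) hs
  have hpt : ∀ n : ℕ, (r ^ n / (n.factorial * ((n : ℝ) + 1) ^ b)) ^ 2 ≤ 2 ^ (2 * b) * F (2 * n) := by
    intro n
    have hn : (0 : ℝ) < 2 * n + 1 := by positivity
    have hc : (n.centralBinom : ℝ) * (2 * n + 1) ^ (1 / 2 : ℝ) ≤ 4 ^ n := by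
      refine le_of_sq_le_sq ?_ (by positivity)
      rw [mul_pow, ← Real.sqrt_eq_rpow, Real.sq_sqrt hn.le, ← pow_mul, mul_comm n 2, pow_mul]
      have := centralBinom_sq_le n
      norm_num
      exact_mod_cast this
    have hcb : (n.centralBinom : ℝ) * (n.factorial * n.factorial) = (2 * n).factorial := by
      have := Nat.choose_mul_factorial_mul_factorial (Nat.le_mul_of_pos_left n two_pos)
      rw [two_mul, Nat.add_sub_cancel, ← two_mul] at this
      rw [← mul_assoc, Nat.centralBinom]
      exact_mod_cast this
    have h1 : (2 * (n : ℝ) + 1) ^ (2 * b) ≤ 2 ^ (2 * b) * ((n : ℝ) + 1) ^ (2 * b) := by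
      rw [← Real.mul_rpow (by norm_num) (by positivity)]
      exact Real.rpow_le_rpow (by positivity) (by linarith) (by positivity)
    have h2 : (((n : ℝ) + 1) ^ b) ^ 2 = ((n : ℝ) + 1) ^ (2 * b) := by
      rw [mul_comm 2 b, Real.rpow_mul (by positivity)]
      norm_cast
    simp only [hF]
    push_cast
    rw [Real.rpow_add hn, div_pow, mul_pow, h2, ← mul_div_assoc,
      div_le_div_iff₀ (by positivity) (by positivity), ← hcb]
    calc (r ^ n) ^ 2 * (n.centralBinom * (n.factorial * n.factorial) *
          ((2 * (n : ℝ) + 1) ^ (2 * b) * (2 * n + 1) ^ (1 / 2 : ℝ)))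
        = (r ^ n) ^ 2 * (n.factorial * n.factorial) * ((2 * (n : ℝ) + 1) ^ (2 * b)) *
          (n.centralBinom * (2 * n + 1) ^ (1 / 2 : ℝ)) := by ring
      _ ≤ (r ^ n) ^ 2 * (n.factorial * n.factorial) * (2 ^ (2 * b) * ((n : ℝ) + 1) ^ (2 * b)) *
          4 ^ n := by gcongr
      _ = _ := by
        have : (4 : ℝ) ^ n = 2 ^ (2 * n) := by rw [pow_mul]; norm_num
        rw [this]; ring
  have hS := (hs2.mul_left (2 ^ (2 * b))).of_nonneg_of_le (fun n => by positivity) hpt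
  refine ⟨hS, (hS.tsum_le_tsum hpt (hs2.mul_left _)).trans ?_⟩
  rw [tsum_mul_left, mul_assoc]
  refine mul_le_mul_of_nonneg_left (hle2.trans (hle.trans ?_)) (by positivity)
  refine mul_le_mul_of_nonneg_left ?_ hC.le
  have e1 : Real.exp (2 * r) = Real.exp r ^ 2 := by rw [two_mul, Real.exp_add, sq]
  have e2 : (r ^ b) ^ 2 * r ^ (1 / 2 : ℝ) = r ^ (2 * b + 1 / 2) := by
    rw [Real.rpow_add hr, mul_comm 2 b, Real.rpow_mul hr.le]
    norm_cast
  rw [e1, div_pow, div_div, e2]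
  gcongr
  linarith

/-! ### Lower density -/

/-- The values of a strictly monotone sequence of linear growth form a set of positive lower
density. -/
theorem lowerDensity_pos {A : Set ℕ} {u : ℕ → ℕ} (hu : StrictMono u) {C : ℕ} (hC : 0 < C)
    (h1 : ∀ t, 1 ≤ u t) (h2 : ∀ t, u t ≤ C * (t + 1)) (hA : ∀ t, u t ∈ A) : 0 < lowerDensity A := by
  have hcount : ∀ N : ℕ, N / C ≤ (A ∩ Set.Icc 1 N).ncard := by
    intro N
    have hsub : u '' (Set.Iio (N / C)) ⊆ A ∩ Set.Icc 1 N := by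
      rintro _ ⟨t, ht, rfl⟩
      refine ⟨hA t, h1 t, (h2 t).trans ?_⟩
      exact (Nat.mul_le_mul_left C (Nat.succ_le_of_lt ht)).trans (Nat.mul_div_le N C)
    have := Set.ncard_le_ncard hsub ((Set.finite_Icc 1 N).subset Set.inter_subset_right)
    rwa [Set.ncard_image_of_injective _ hu.injective, Set.ncard_Iio_nat] at this
  have hbdd : IsBoundedUnder (· ≤ ·) atTop
      (fun N : ℕ => ((A ∩ Set.Icc 1 N).ncard : ℝ) / (N : ℝ)) := by
    refine ⟨1, eventually_map.2 (Eventually.of_forall fun N => ?_)⟩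
    refine div_le_one_of_le₀ ?_ (by positivity)
    have := Set.ncard_le_ncard (Set.inter_subset_right : A ∩ Set.Icc 1 N ⊆ _) (Set.finite_Icc 1 N)
    rw [Set.ncard_eq_toFinset_card' (Set.Icc 1 N)] at this
    simp only [Set.toFinset_Icc, Nat.card_Icc, Nat.add_sub_cancel] at this
    exact_mod_cast this
  have hC' : (0 : ℝ) < C := by exact_mod_cast hC
  refine lt_of_lt_of_le (b := 1 / (2 * (C : ℝ))) (by positivity) ?_
  refine le_liminf_of_le hbdd.isCoboundedUnder_ge ?_
  filter_upwards [eventually_ge_atTop (2 * C)] with N hN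
  have hN' : (2 : ℝ) * C ≤ N := by exact_mod_cast hN
  have h3 : (N : ℝ) / C - 1 ≤ ((N / C : ℕ) : ℝ) := by
    have := Nat.lt_div_mul_add hC (a := N)
    have h4 : (N : ℝ) < ((N / C : ℕ) : ℝ) * C + C := by exact_mod_cast this
    rw [sub_le_iff_le_add, div_le_iff₀ hC']
    linarith
  have h5 : ((N / C : ℕ) : ℝ) ≤ (A ∩ Set.Icc 1 N).ncard := by exact_mod_cast hcount N
  rw [le_div_iff₀ (by linarith)]
  refine le_trans ?_ (h3.trans h5)
  rw [one_div, inv_mul_le_iff₀ (by positivity)]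
  field_simp
  linarith

/-! ### A frequently recurrent coefficient sequence -/

/-- Starting position of the `i`-th block. The gap after block `i` exceeds the `2`-adic valuations
of both `i` and `i + 1`, while the positions grow linearly because the valuations are bounded on
average. -/
def blockStart : ℕ → ℕ
  | 0 => 0
  | i + 1 => blockStart i + padicValNat 2 i + padicValNat 2 (i + 1) + 1

theorem blockStart_gap {i k : ℕ} (h : i < k) :
    blockStart i + padicValNat 2 i + padicValNat 2 k + 1 ≤ blockStart k := by
  induction k, h using Nat.le_induction with
  | base => exact le_rfl
  | succ k _ ih => rw [blockStart]; omega

theorem blockStart_strictMono : StrictMono blockStart := fun _ _ h => by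
  have := blockStart_gap h
  omega

theorem blockStart_add_padicValNat (i : ℕ) :
    blockStart i + padicValNat 2 i = i + 2 * padicValNat 2 i.factorial := by
  induction i with
  | zero => simp [blockStart]
  | succ i ih =>
    rw [blockStart, Nat.factorial_succ, padicValNat.mul (by omega) (Nat.factorial_ne_zero i)]
    omega

theorem blockStart_le (i : ℕ) : blockStart i ≤ 3 * i := by
  have h1 := blockStart_add_padicValNat i
  have h2 := sub_one_mul_padicValNat_factorial (p := 2) i
  omega

/-- The index of the last block starting at or before the position `n`. -/
def blockIndex (n : ℕ) : ℕ := Nat.findGreatest (fun i => blockStart i ≤ n) n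

theorem blockStart_blockIndex_le (n : ℕ) : blockStart (blockIndex n) ≤ n :=
  Nat.findGreatest_spec (P := fun i => blockStart i ≤ n) (Nat.zero_le n) (Nat.zero_le n)

theorem le_blockIndex (i j : ℕ) : i ≤ blockIndex (blockStart i + j) :=
  Nat.le_findGreatest ((blockStart_strictMono.id_le i).trans (Nat.le_add_right _ _))
    (Nat.le_add_right _ _)

theorem blockIndex_eq {i j : ℕ} (hj : j ≤ padicValNat 2 i) :
    blockIndex (blockStart i + j) = i := by
  refine le_antisymm ?_ (le_blockIndex i j)
  by_contra! h
  have h1 := blockStart_gap h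
  have h2 := blockStart_blockIndex_le (blockStart i + j)
  omega

/-- A list of finite words indexed by `ℕ`: the word with index `pair (pair k L) t` consists of the
first `L` terms of the `k`-th element of a dense sequence in `ℕ → ℂ`, where letters that are too
late or too large for the index are replaced by `0`. The free parameter `t` makes each word recur
with arbitrarily large index, so the truncation is harmless. -/
noncomputable def word (v j : ℕ) : ℂ :=
  if j < v.unpair.1.unpair.2 ∧ j ≤ v ∧
    ‖TopologicalSpace.denseSeq (ℕ → ℂ) v.unpair.1.unpair.1 j‖ ≤ v
  then TopologicalSpace.denseSeq (ℕ → ℂ) v.unpair.1.unpair.1 j else 0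

theorem norm_word_le (v j : ℕ) : ‖word v j‖ ≤ v := by
  unfold word
  split_ifs with h
  · exact h.2.2
  · simp

theorem word_eq_zero {v j : ℕ} (h : v < j) : word v j = 0 :=
  if_neg fun h' => absurd h'.2.1 (not_le.2 h)

theorem exists_word (b : ℕ → ℂ) (M : ℕ) {ε : ℝ} (hε : 0 < ε) :
    ∃ v, M ≤ v ∧ (∀ j < M, ‖word v j - b j‖ < ε) ∧ ∀ j, M ≤ j → word v j = 0 := by
  have hopen : IsOpen ((Set.Iio M).pi fun j => Metric.ball (b j) ε) :=
    isOpen_set_pi (Set.finite_Iio M) fun _ _ => Metric.isOpen_ball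
  obtain ⟨k, hk⟩ := (TopologicalSpace.denseRange_denseSeq (ℕ → ℂ)).exists_mem_open hopen
    ⟨b, fun j _ => Metric.mem_ball_self hε⟩
  set q := TopologicalSpace.denseSeq (ℕ → ℂ) k with hq
  -- Words of index at least `max M t` are long enough for `M` letters of the sizes occurring here.
  obtain ⟨t, ht⟩ := exists_nat_ge (∑ j ∈ Finset.range M, ‖q j‖)
  have hv : max M t ≤ Nat.pair (Nat.pair k M) (max M t) := Nat.right_le_pair _ _
  refine ⟨Nat.pair (Nat.pair k M) (max M t), (le_max_left _ _).trans hv, fun j hj => ?_,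
    fun j hj => ?_⟩
  · have h1 : ‖q j‖ ≤ Nat.pair (Nat.pair k M) (max M t) := by
      refine (Finset.single_le_sum (f := fun j => ‖q j‖) (fun _ _ => norm_nonneg _)
        (Finset.mem_range.2 hj)).trans (ht.trans ?_)
      exact_mod_cast (le_max_right M t).trans hv
    have h2 : word (Nat.pair (Nat.pair k M) (max M t)) j = q j := by
      unfold word
      simp only [Nat.unpair_pair]
      exact if_pos ⟨hj, hj.le.trans ((le_max_left _ _).trans hv), h1⟩
    rw [h2, ← dist_eq_norm]
    exact hk j hj
  · unfold word
    simp only [Nat.unpair_pair]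
    exact if_neg fun h => absurd h.1 (not_lt.2 hj)

open Classical in
/-- The sequence carrying on its `i`-th block the word with index the `2`-adic valuation of `i`;
letters of the word `v` are admitted only at the positions `n` with `P v n`. -/
noncomputable def blockCoeff (P : ℕ → ℕ → Prop) (n : ℕ) : ℂ :=
  if P (padicValNat 2 (blockIndex n)) n
  then word (padicValNat 2 (blockIndex n)) (n - blockStart (blockIndex n)) else 0

theorem blockCoeff_eq_zero_or (P : ℕ → ℕ → Prop) (n : ℕ) :
    blockCoeff P n = 0 ∨ ∃ v : ℕ, P v n ∧ ‖blockCoeff P n‖ ≤ v := by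
  unfold blockCoeff
  split_ifs with h
  · exact Or.inr ⟨_, h, norm_word_le _ _⟩
  · exact Or.inl rfl

/-- Seen from the start of a block, the sequence grows at most linearly beyond that block: a later
block with large letters is also far away. -/
theorem norm_blockCoeff_le (P : ℕ → ℕ → Prop) {i j : ℕ} (hj : padicValNat 2 i < j) :
    ‖blockCoeff P (blockStart i + j)‖ ≤ j := by
  unfold blockCoeff
  split_ifs with h
  · rcases (le_blockIndex i j).eq_or_lt with h1 | h1
    · rw [← h1, Nat.add_sub_cancel_left, word_eq_zero hj]
      simp
    · refine (norm_word_le _ _).trans ?_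
      have h2 := blockStart_gap h1
      have h3 := blockStart_blockIndex_le (blockStart i + j)
      have : padicValNat 2 (blockIndex (blockStart i + j)) ≤ j := by omega
      exact_mod_cast this
  · simp

/-- Every finite pattern is approximated along a set of positions of linear growth, with linearly
bounded entries after the pattern. -/
theorem exists_blockCoeff_near {P : ℕ → ℕ → Prop} (hP : ∀ v, ∀ᶠ n in atTop, P v n)
    (b : ℕ → ℂ) (M : ℕ) {ε : ℝ} (hε : 0 < ε) :
    ∃ u : ℕ → ℕ, StrictMono u ∧ ∃ C : ℕ, 0 < C ∧ (∀ t, 1 ≤ u t) ∧ (∀ t, u t ≤ C * (t + 1)) ∧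
      ∀ t, (∀ j < M, ‖blockCoeff P (u t + j) - b j‖ < ε) ∧
        ∀ j, M ≤ j → ‖blockCoeff P (u t + j)‖ ≤ j := by
  obtain ⟨v, hMv, hnear, hzero⟩ := exists_word b M hε
  obtain ⟨T, hT⟩ := eventually_atTop.1 (hP v)
  -- The indices of `2`-adic valuation `v` above `T`, where the word `v` is admitted.
  set w : ℕ → ℕ := fun t => 2 ^ v * (2 * (t + T) + 1) with hw
  have hval : ∀ t, padicValNat 2 (w t) = v := by
    intro t
    simp only [hw]
    rw [padicValNat.mul (by positivity) (by omega), padicValNat.prime_pow,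
      padicValNat.eq_zero_of_not_dvd (by omega), add_zero]
  have h2v : 1 ≤ 2 ^ v := Nat.one_le_two_pow
  have hwt : ∀ t, t + T + 1 ≤ w t := fun t => by
    have : 1 * (2 * (t + T) + 1) ≤ w t := Nat.mul_le_mul_right _ h2v
    omega
  have hsw : ∀ t, w t ≤ blockStart (w t) := fun t => blockStart_strictMono.id_le _
  refine ⟨fun t => blockStart (w t), fun s t hst => blockStart_strictMono ?_,
    3 * (2 ^ v * (2 * T + 2)), by positivity, fun t => ?_, fun t => ?_, fun t => ⟨?_, ?_⟩⟩
  · exact Nat.mul_lt_mul_of_pos_left (by omega) (by positivity)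
  · have := hwt t
    exact le_trans (by omega) (hsw t)
  · refine (blockStart_le _).trans ?_
    rw [mul_assoc, mul_assoc]
    refine Nat.mul_le_mul_left 3 (Nat.mul_le_mul_left _ ?_)
    nlinarith
  all_goals
    have hin : ∀ j ≤ v, blockCoeff P (blockStart (w t) + j) = word v j := by
      intro j hj
      have hidx : blockIndex (blockStart (w t) + j) = w t := blockIndex_eq (by rwa [hval])
      unfold blockCoeff
      rw [hidx, hval, Nat.add_sub_cancel_left]
      refine if_pos (hT _ ?_)
      have := hwt t
      have := hsw t
      omega
  · intro j hj
    rw [hin j (by omega)]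
    exact hnear j hj
  · intro j hj
    rcases le_or_gt j v with h | h
    · rw [hin j h, hzero j hj]
      simp
    · exact norm_blockCoeff_le P (by rwa [hval])

/-! ### The Dunkl operator as a backward shift -/

theorem summable_norm_of_hasSum {c : ℕ → ℂ} {F : ℂ → ℂ}
    (h : ∀ z, HasSum (fun n => c n * z ^ n) (F z)) {R : ℝ} (hR : 0 ≤ R) :
    Summable fun n => ‖c n‖ * R ^ n := by
  refine (h R).summable.norm.congr fun n => ?_
  rw [norm_mul, norm_pow, Complex.norm_real, Real.norm_of_nonneg hR]

/-- On power series normalized by the Dunkl factorials, the Dunkl operator is the backward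
shift. -/
theorem hasSum_dunklFun {α : ℝ} (hα : -(1 / 2) < α) {b : ℕ → ℂ} {F : ℂ → ℂ}
    (h : ∀ z, HasSum (fun n => b n / dunklFactorial α n * z ^ n) (F z)) (z : ℂ) :
    HasSum (fun n => b (n + 1) / dunklFactorial α n * z ^ n) (dunklFun α F z) := by
  have hd : ∀ n, (dunklFactorial α n : ℂ) ≠ 0 := fun n => by
    exact_mod_cast (dunklFactorial_pos hα n).ne'
  have hderiv : ∀ z, HasSum (fun n : ℕ => b n / dunklFactorial α n * (n * z ^ (n - 1)))
      (deriv F z) := by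
    intro z
    have hF : F = fun w => ∑' n, b n / dunklFactorial α n * w ^ n := by
      funext w
      exact (h w).tsum_eq.symm
    have := Complex.hasSum_deriv_of_summable_norm (U := Metric.ball 0 (‖z‖ + 1)) (z := z)
      (F := fun n w => b n / dunklFactorial α n * w ^ n)
      (summable_norm_of_hasSum h (by positivity : 0 ≤ ‖z‖ + 1))
      (fun n => by fun_prop) Metric.isOpen_ball
      (fun n w hw => by
        rw [norm_mul, norm_pow]
        have : ‖w‖ ≤ ‖z‖ + 1 := (mem_ball_zero_iff.1 hw).le
        gcongr)
      (by simp)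
    rw [← hF] at this
    refine this.congr_fun fun n => ?_
    rw [deriv_const_mul _ (by fun_prop), deriv_pow_field]
  have hmul : ∀ n, (dunklFactorial α (n + 1) : ℂ) =
      (n + 1 + if Even n then 2 * α + 1 else 0) * dunklFactorial α n := fun n => by
    rw [dunklFactorial]
    split_ifs <;> push_cast <;> rfl
  unfold dunklFun
  split_ifs with hz
  -- At the origin only the coefficient of `z` survives, and its weight is `2α + 2`.
  · subst hz
    have h1 : deriv F 0 = b 1 / dunklFactorial α 1 := by
      refine (hderiv 0).unique ?_
      convert hasSum_single 1 ?_ using 1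
      · simp
      · intro n hn
        rcases Nat.eq_zero_or_pos n with rfl | hn0
        · simp
        · simp [zero_pow (by omega : n - 1 ≠ 0)]
    convert hasSum_single 0 ?_ using 1
    · have h2 := hmul 0
      have h3 := hd 1
      have h4 := hd 0
      simp only [zero_add, CharP.cast_eq_zero, Even.zero, if_true] at h2
      rw [h1, h2, pow_zero, mul_one, zero_add]
      rw [h2] at h3
      have h5 := left_ne_zero_of_mul h3
      push_cast at h5 ⊢
      field_simp
      ring
    · intro n hn
      simp [zero_pow hn]
  · have h1 := (hderiv z).add ((((h z).sub (h (-z))).div_const 2).mul_left ((2 * α + 1) / z))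
    rw [← hasSum_nat_add_iff' 1, Finset.sum_range_one] at h1
    simp only [Nat.cast_zero, zero_mul, mul_zero, pow_zero, sub_self, zero_div, add_zero,
      sub_zero, Nat.add_sub_cancel] at h1
    refine h1.congr_fun fun n => ?_
    have h2 := hmul n
    have h3 := hd (n + 1)
    have h4 := hd n
    rw [h2] at h3 ⊢
    have h5 := left_ne_zero_of_mul h3
    rcases Nat.even_or_odd n with he | ho
    · rw [if_pos he] at h5 ⊢
      rw [he.add_one.neg_pow z]
      push_cast at h5 ⊢
      field_simp
      ring
    · rw [if_neg (Nat.not_even_iff_odd.2 ho)] at h5 ⊢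
      rw [ho.add_one.neg_pow z]
      push_cast at h5 ⊢
      field_simp
      ring

theorem hasSum_dunkl_iterate {α : ℝ} (hα : -(1 / 2) < α) {b : ℕ → ℂ} {f : EntireFunctions}
    (h : ∀ z, HasSum (fun n => b n / dunklFactorial α n * z ^ n) (f.1 z)) (N : ℕ) (z : ℂ) :
    HasSum (fun n => b (N + n) / dunklFactorial α n * z ^ n) (((dunkl α)^[N] f).1 z) := by
  induction N generalizing z with
  | zero => simpa using h z
  | succ N ih =>
    rw [Function.iterate_succ_apply']
    refine (hasSum_dunklFun hα ih z).congr_fun fun n => ?_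
    rw [add_right_comm, add_assoc]

theorem summable_nat_mul_pow_div_dunklFactorial {α : ℝ} (hα : -(1 / 2) < α) {R : ℝ}
    (hR : 0 ≤ R) : Summable fun n : ℕ => (n : ℝ) / dunklFactorial α n * R ^ n := by
  have h1 : Summable fun n : ℕ => (n : ℝ) / n.factorial * R ^ n := by
    rw [← summable_nat_add_iff 1]
    refine ((Real.summable_pow_div_factorial R).mul_left R).congr fun n => ?_
    rw [Nat.factorial_succ]
    push_cast
    field_simp
    ring
  refine h1.of_nonneg_of_le (fun n => ?_) fun n => ?_
  · have := dunklFactorial_pos hα n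
    positivity
  · have := factorial_le_dunklFactorial hα n
    gcongr

theorem exists_entire_of_norm_le {α : ℝ} (hα : -(1 / 2) < α) {a : ℕ → ℂ} (ha : ∀ n, ‖a n‖ ≤ n) :
    ∃ f : EntireFunctions, ∀ z, HasSum (fun n => a n / dunklFactorial α n * z ^ n) (f.1 z) := by
  have hb : ∀ (R : ℝ) (n : ℕ) (w : ℂ), ‖w‖ ≤ R →
      ‖a n / dunklFactorial α n * w ^ n‖ ≤ n / dunklFactorial α n * R ^ n := by
    intro R n w hw
    have hd := dunklFactorial_pos hα n
    rw [norm_mul, norm_pow, norm_div, Complex.norm_real, Real.norm_of_nonneg hd.le]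
    have := ha n
    gcongr
  have hdiff : Differentiable ℂ fun z : ℂ => ∑' n, a n / dunklFactorial α n * z ^ n := by
    intro z
    have := Complex.differentiableOn_tsum_of_summable_norm (U := Metric.ball 0 (‖z‖ + 1))
      (F := fun n w => a n / dunklFactorial α n * w ^ n)
      (summable_nat_mul_pow_div_dunklFactorial hα (by positivity : 0 ≤ ‖z‖ + 1))
      (fun n => by fun_prop) Metric.isOpen_ball
      (fun n w hw => hb _ n w (mem_ball_zero_iff.1 hw).le)
    exact this.differentiableAt (Metric.isOpen_ball.mem_nhds (by simp))
  refine ⟨⟨⟨_, hdiff.continuous⟩, hdiff⟩, fun z => ?_⟩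
  exact (Summable.of_norm_bounded
    (summable_nat_mul_pow_div_dunklFactorial hα (norm_nonneg z)) (fun n => hb _ n z le_rfl)).hasSum

/-! ### Frequent hypercyclicity -/

theorem exists_ball_subset_of_isOpen {U : Set EntireFunctions} (hU : IsOpen U)
    {g : EntireFunctions} (hg : g ∈ U) :
    ∃ R : ℝ, 0 ≤ R ∧ ∃ δ : ℝ, 0 < δ ∧ ∀ h : EntireFunctions,
      (∀ z : ℂ, ‖z‖ ≤ R → ‖h.1 z - g.1 z‖ < δ) → h ∈ U := by
  obtain ⟨V, hV, rfl⟩ := isOpen_induced_iff.1 hU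
  obtain ⟨⟨K, W⟩, ⟨hK, hW⟩, hsub⟩ := (nhds_basis_uniformity'
    (ContinuousMap.hasBasis_compactConvergenceUniformity (α := ℂ) (β := ℂ))).mem_iff.1
    (hV.mem_nhds hg)
  obtain ⟨δ, hδ, hδW⟩ := Metric.mem_uniformity_dist.1 hW
  obtain ⟨R, hR⟩ := hK.isBounded.subset_closedBall 0
  refine ⟨max R 0, le_max_right _ _, δ, hδ, fun h hh => hsub fun z hz => hδW ?_⟩
  rw [dist_comm, dist_eq_norm]
  exact hh z ((mem_closedBall_zero_iff.1 (hR hz)).trans (le_max_left _ _))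

theorem exists_hasSum_dunklFactorial {α : ℝ} (hα : -(1 / 2) < α) {g : ℂ → ℂ}
    (hg : Differentiable ℂ g) :
    ∃ b : ℕ → ℂ, ∀ z, HasSum (fun n => b n / dunklFactorial α n * z ^ n) (g z) := by
  refine ⟨fun n => dunklFactorial α n * ((n.factorial : ℂ)⁻¹ * iteratedDeriv n g 0), fun z => ?_⟩
  refine (Complex.hasSum_taylorSeries_of_entire hg 0 z).congr_fun fun n => ?_
  have : (dunklFactorial α n : ℂ) ≠ 0 := by exact_mod_cast (dunklFactorial_pos hα n).ne'
  simp only [smul_eq_mul, sub_zero]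
  field_simp

/-- A series whose coefficients form a block sequence is frequently hypercyclic: at the start of
suitable blocks the shifted coefficients agree approximately with the first `M` coefficients of the
target, and the remaining ones grow at most linearly, which the Dunkl factorials suppress. -/
theorem isFrequentlyHypercyclicVector_of_blockCoeff {α : ℝ} (hα : -(1 / 2) < α)
    {P : ℕ → ℕ → Prop} (hP : ∀ v, ∀ᶠ n in atTop, P v n) {f : EntireFunctions}
    (hf : ∀ z, HasSum (fun n => blockCoeff P n / dunklFactorial α n * z ^ n) (f.1 z)) :
    IsFrequentlyHypercyclicVector (dunkl α) f := by
  rintro U hU ⟨g, hg⟩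
  obtain ⟨R, hR, δ, hδ, hsub⟩ := exists_ball_subset_of_isOpen hU hg
  obtain ⟨b, hb⟩ := exists_hasSum_dunklFactorial hα g.2
  have hd := dunklFactorial_pos hα
  have hdn : ∀ n, ‖(dunklFactorial α n : ℂ)‖ = dunklFactorial α n := fun n => by
    rw [Complex.norm_real, Real.norm_of_nonneg (hd n).le]
  have hy : Summable fun n : ℕ => (n + ‖b n‖) / dunklFactorial α n * R ^ n := by
    refine ((summable_nat_mul_pow_div_dunklFactorial hα hR).add
      (summable_norm_of_hasSum hb hR)).congr fun n => ?_
    rw [norm_div, hdn]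
    ring
  -- Cut where the sum of the linear growth of `f` and the coefficients of `g` has a small tail.
  obtain ⟨M, hM⟩ := ((tendsto_order.1 (tendsto_sum_nat_add
    fun n : ℕ => (n + ‖b n‖) / dunklFactorial α n * R ^ n)).2 (δ / 2) (by positivity)).exists
  set S := ∑ n ∈ Finset.range M, R ^ n / dunklFactorial α n with hS
  have hS0 : 0 ≤ S := Finset.sum_nonneg fun n _ => div_nonneg (by positivity) (hd n).le
  obtain ⟨u, hu, C, hC, h1, h2, h3⟩ :=
    exists_blockCoeff_near hP b M (ε := δ / 2 / (S + 1)) (by positivity)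
  refine lowerDensity_pos hu hC h1 h2 fun t => hsub _ fun z hz => ?_
  have hdiff := (hasSum_dunkl_iterate hα hf (u t) z).sub (hb z)
  have hsum := hdiff.summable.norm
  have hterm : ∀ n, ‖blockCoeff P (u t + n) / dunklFactorial α n * z ^ n -
      b n / dunklFactorial α n * z ^ n‖ ≤
      ‖blockCoeff P (u t + n) - b n‖ * (R ^ n / dunklFactorial α n) := by
    intro n
    rw [← sub_mul, ← sub_div, norm_mul, norm_div, hdn, norm_pow, div_mul_eq_mul_div,
      ← mul_div_assoc]
    have := hd n
    gcongr
  rw [← hdiff.tsum_eq]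
  refine (norm_tsum_le_tsum_norm hsum).trans_lt ?_
  rw [← hsum.sum_add_tsum_nat_add M]
  have hfirst : ∑ n ∈ Finset.range M, ‖blockCoeff P (u t + n) / dunklFactorial α n * z ^ n -
      b n / dunklFactorial α n * z ^ n‖ ≤ δ / 2 := by
    calc _ ≤ ∑ n ∈ Finset.range M, δ / 2 / (S + 1) * (R ^ n / dunklFactorial α n) := by
          refine Finset.sum_le_sum fun n hn => (hterm n).trans ?_
          refine mul_le_mul_of_nonneg_right ((h3 t).1 n (Finset.mem_range.1 hn)).le ?_
          exact div_nonneg (by positivity) (hd n).le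
      _ = δ / 2 * (S / (S + 1)) := by rw [← Finset.mul_sum]; ring
      _ ≤ δ / 2 * 1 := by
          gcongr
          exact div_le_one_of_le₀ (by linarith) (by positivity)
      _ = δ / 2 := mul_one _
  have htail : ∑' n : ℕ, ‖blockCoeff P (u t + (n + M)) / dunklFactorial α (n + M) * z ^ (n + M) -
      b (n + M) / dunklFactorial α (n + M) * z ^ (n + M)‖ < δ / 2 := by
    refine lt_of_le_of_lt (Summable.tsum_le_tsum (fun n => ?_) ((summable_nat_add_iff M).2 hsum)
      ((summable_nat_add_iff M).2 hy)) hM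
    refine (hterm _).trans ?_
    rw [div_mul_eq_mul_div, ← mul_div_assoc]
    have := hd (n + M)
    gcongr
    exact (norm_sub_le _ _).trans (by gcongr; exact (h3 t).2 _ (Nat.le_add_left _ _))
  linarith

/-! ### Integral means of power series -/

open Polynomial in
/-- Bessel's inequality on a circle. -/
theorem circle_mean_sq_le {c : ℕ → ℂ} {F : ℂ → ℂ} (h : ∀ z, HasSum (fun n => c n * z ^ n) (F z))
    {r : ℝ} (hr : 0 ≤ r) (hs : Summable fun n => (‖c n‖ * r ^ n) ^ 2) :
    1 / (2 * Real.pi) * ∫ t in (0 : ℝ)..(2 * Real.pi), ‖F (r * Complex.exp (t * Complex.I))‖ ^ 2 ≤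
      ∑' n, (‖c n‖ * r ^ n) ^ 2 := by
  have hnorm := summable_norm_of_hasSum h hr
  set q : ℕ → ℂ[X] := fun N => ∑ n ∈ Finset.range N, C (c n * r ^ n) * X ^ n with hq
  have hqe : ∀ N z, (q N).eval z = ∑ n ∈ Finset.range N, c n * (r * z) ^ n := by
    intro N z
    simp only [hq, eval_finsetSum, eval_mul, eval_C, eval_pow, eval_X]
    exact Finset.sum_congr rfl fun n _ => by rw [mul_pow]; ring
  have hqc : ∀ N n, ‖(q N).coeff n‖ ≤ ‖c n‖ * r ^ n := by
    intro N n
    simp only [hq, finsetSum_coeff, coeff_C_mul_X_pow]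
    rw [Finset.sum_ite_eq]
    split_ifs
    · rw [norm_mul, norm_pow, Complex.norm_real, Real.norm_of_nonneg hr]
    · rw [norm_zero]; positivity
  have hle : ∀ N, 1 / (2 * Real.pi) * ∫ t in (0 : ℝ)..(2 * Real.pi),
      ‖(q N).eval (Complex.exp (t * Complex.I))‖ ^ 2 ≤ ∑' n, (‖c n‖ * r ^ n) ^ 2 := by
    intro N
    have h1 := (q N).sum_sq_norm_coeff_eq_circleAverage
    simp only [Real.circleAverage_def, circleMap, Complex.ofReal_one, one_mul, zero_add,
      smul_eq_mul] at h1
    rw [one_div, ← h1]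
    refine (Finset.sum_le_sum fun n _ => ?_).trans (hs.sum_le_tsum _ fun n _ => by positivity)
    exact pow_le_pow_left₀ (norm_nonneg _) (hqc N n) 2
  have hbound : ∀ N (t : ℝ), ‖(q N).eval (Complex.exp (t * Complex.I))‖ ≤
      ∑' n, ‖c n‖ * r ^ n := by
    intro N t
    rw [hqe]
    refine (norm_sum_le _ _).trans (le_trans (Finset.sum_le_sum fun n _ => ?_)
      (hnorm.sum_le_tsum _ fun n _ => by positivity))
    rw [norm_mul, norm_pow, norm_mul, Complex.norm_exp_ofReal_mul_I, Complex.norm_real,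
      Real.norm_of_nonneg hr, mul_one]
  have hlim : Tendsto (fun N => ∫ t in (0 : ℝ)..(2 * Real.pi),
      ‖(q N).eval (Complex.exp (t * Complex.I))‖ ^ 2) atTop
      (𝓝 (∫ t in (0 : ℝ)..(2 * Real.pi), ‖F (r * Complex.exp (t * Complex.I))‖ ^ 2)) := by
    refine intervalIntegral.tendsto_integral_filter_of_dominated_convergence
      (fun _ => (∑' n, ‖c n‖ * r ^ n) ^ 2) (Eventually.of_forall fun N => ?_)
      (Eventually.of_forall fun N => Eventually.of_forall fun t _ => ?_)
      intervalIntegrable_const (Eventually.of_forall fun t _ => ?_)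
    · exact Continuous.aestronglyMeasurable (by fun_prop)
    · rw [Real.norm_of_nonneg (by positivity)]
      exact pow_le_pow_left₀ (norm_nonneg _) (hbound N t) 2
    · simp only [hqe]
      exact (h _).tendsto_sum_nat.norm.pow 2
  exact le_of_tendsto' (hlim.const_mul _) hle

theorem integralMean_top_le {F : ℂ → ℂ} {r A : ℝ} (hA : 0 ≤ A) (h : ∀ z, ‖z‖ = r → ‖F z‖ ≤ A) :
    integralMean ∞ F r ≤ A := by
  rw [integralMean, if_pos rfl]
  exact Real.iSup_le (fun z => h z (mem_sphere_zero_iff_norm.1 z.2)) hA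

theorem integralMean_le_of_rpow_le {p : ℝ≥0∞} (hp : 1 ≤ p) (hp' : p ≠ ∞) {F : ℂ → ℂ}
    (hF : Continuous F) {r a b B : ℝ} (hB : 0 ≤ B)
    (h : ∀ t : ℝ, ‖F (r * Complex.exp (t * Complex.I))‖ ^ p.toReal ≤
      a + b * ‖F (r * Complex.exp (t * Complex.I))‖ ^ 2)
    (hm : a + b * (1 / (2 * Real.pi) * ∫ t in (0 : ℝ)..(2 * Real.pi),
      ‖F (r * Complex.exp (t * Complex.I))‖ ^ 2) ≤ B ^ p.toReal) :
    integralMean p F r ≤ B := by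
  have hp1 : 1 ≤ p.toReal := by
    rw [← ENNReal.toReal_one]
    exact ENNReal.toReal_mono hp' hp
  have hp0 : 0 < p.toReal := by linarith
  have hpi : 0 < 2 * Real.pi := by positivity
  rw [integralMean, if_neg hp', one_div p.toReal]
  have hc : Continuous fun t : ℝ => ‖F (r * Complex.exp (t * Complex.I))‖ := by fun_prop
  have hint : ∫ t in (0 : ℝ)..(2 * Real.pi), ‖F (r * Complex.exp (t * Complex.I))‖ ^ p.toReal ≤
      ∫ t in (0 : ℝ)..(2 * Real.pi), (a + b * ‖F (r * Complex.exp (t * Complex.I))‖ ^ 2) := by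
    refine intervalIntegral.integral_mono_on hpi.le
      ((hc.rpow_const fun _ => Or.inr hp0.le).intervalIntegrable _ _)
      (Continuous.intervalIntegrable (by fun_prop) _ _) fun t _ => h t
  rw [intervalIntegral.integral_add intervalIntegrable_const
    (Continuous.intervalIntegrable (by fun_prop) _ _), intervalIntegral.integral_const,
    intervalIntegral.integral_const_mul, sub_zero, smul_eq_mul] at hint
  refine (Real.rpow_le_rpow ?_ (le_trans ?_ hm) (by positivity)).trans
    (le_of_eq (Real.rpow_rpow_inv hB hp0.ne'))
  · have : 0 ≤ ∫ t in (0 : ℝ)..(2 * Real.pi), ‖F (r * Complex.exp (t * Complex.I))‖ ^ p.toReal :=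
      intervalIntegral.integral_nonneg hpi.le fun t _ => by positivity
    positivity
  · have hscale : ∀ I : ℝ, 1 / (2 * Real.pi) * (2 * Real.pi * a + b * I) =
        a + b * (1 / (2 * Real.pi) * I) := fun I => by field_simp
    exact (mul_le_mul_of_nonneg_left hint (by positivity)).trans (le_of_eq (hscale _))

/-- For `p ≤ 2` the mean of order `p` is controlled by the quadratic mean, via
`x ^ p ≤ 1 + x ^ 2`. -/
theorem integralMean_le_of_le_two {p : ℝ≥0∞} (hp : 1 ≤ p) (hp2 : p ≤ 2) {F : ℂ → ℂ}
    (hF : Continuous F) {r B : ℝ} (hB : 0 < B)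
    (hm : 1 / (2 * Real.pi) * ∫ t in (0 : ℝ)..(2 * Real.pi),
      ‖F (r * Complex.exp (t * Complex.I))‖ ^ 2 ≤ B ^ 2) :
    integralMean p F r ≤ 2 * B := by
  have hp' : p ≠ ∞ := (hp2.trans_lt ENNReal.ofNat_lt_top).ne
  have hp1 : 1 ≤ p.toReal := by
    rw [← ENNReal.toReal_one]
    exact ENNReal.toReal_mono hp' hp
  have hp2' : p.toReal ≤ 2 := by
    simpa using ENNReal.toReal_mono ENNReal.ofNat_ne_top hp2
  refine integralMean_le_of_rpow_le hp hp' hF (a := B ^ p.toReal) (b := B ^ p.toReal / B ^ 2)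
    (by positivity) (fun t => ?_) ?_
  · set x := ‖F (r * Complex.exp (t * Complex.I))‖
    have hx : 0 ≤ x / B := by positivity
    have h1 : (x / B) ^ p.toReal ≤ 1 + (x / B) ^ 2 := by
      rcases le_total (x / B) 1 with h | h
      · exact (Real.rpow_le_one hx h (by linarith)).trans
          (le_add_of_nonneg_right (by positivity))
      · rw [← Real.rpow_two]
        exact (Real.rpow_le_rpow_of_exponent_le h hp2').trans (by linarith)
    calc x ^ p.toReal = B ^ p.toReal * (x / B) ^ p.toReal := by
          rw [← Real.mul_rpow hB.le hx, mul_div_cancel₀ _ hB.ne']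
      _ ≤ B ^ p.toReal * (1 + (x / B) ^ 2) := by gcongr
      _ = _ := by rw [div_pow]; ring
  · have h2 : (2 : ℝ) ≤ 2 ^ p.toReal := by
      simpa using Real.rpow_le_rpow_of_exponent_le (one_le_two (α := ℝ)) hp1
    calc _ ≤ B ^ p.toReal + B ^ p.toReal / B ^ 2 * B ^ 2 := by gcongr
      _ = 2 * B ^ p.toReal := by field_simp; ring
      _ ≤ 2 ^ p.toReal * B ^ p.toReal := by gcongr
      _ = _ := (Real.mul_rpow (by norm_num) hB.le).symm

/-- For `2 ≤ p < ∞` the mean of order `p` interpolates between the quadratic mean and the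
maximum. -/
theorem integralMean_le_of_two_le {p : ℝ≥0∞} (hp2 : 2 ≤ p) (hp' : p ≠ ∞) {F : ℂ → ℂ}
    (hF : Continuous F) {r A D : ℝ} (hr : 0 ≤ r) (hA : 0 < A) (hD : 0 < D)
    (hsup : ∀ z, ‖z‖ = r → ‖F z‖ ≤ A)
    (hm : 1 / (2 * Real.pi) * ∫ t in (0 : ℝ)..(2 * Real.pi),
      ‖F (r * Complex.exp (t * Complex.I))‖ ^ 2 ≤ (A * D) ^ 2) :
    integralMean p F r ≤ A * D ^ (2 / p.toReal) := by
  have hp2' : 2 ≤ p.toReal := by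
    simpa using ENNReal.toReal_mono hp' hp2
  have hp0 : 0 < p.toReal := by linarith
  refine integralMean_le_of_rpow_le (one_le_two.trans hp2) hp' hF (a := 0)
    (b := A ^ (p.toReal - 2)) (by positivity) (fun t => ?_) ?_
  · have hx := hsup (r * Complex.exp (t * Complex.I)) (by
      rw [norm_mul, Complex.norm_exp_ofReal_mul_I, Complex.norm_real, Real.norm_of_nonneg hr,
        mul_one])
    set x := ‖F (r * Complex.exp (t * Complex.I))‖
    have hx0 : 0 ≤ x := norm_nonneg _
    calc x ^ p.toReal = x ^ (p.toReal - 2) * x ^ 2 := by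
          rw [← Real.rpow_two, ← Real.rpow_add' hx0 (by linarith), sub_add_cancel]
      _ ≤ A ^ (p.toReal - 2) * x ^ 2 := by
          gcongr
      _ = _ := (zero_add _).symm
  · calc _ ≤ 0 + A ^ (p.toReal - 2) * (A * D) ^ 2 := by gcongr
      _ = (A ^ (p.toReal - 2) * A ^ 2) * D ^ 2 := by ring
      _ = A ^ p.toReal * D ^ 2 := by
          rw [← Real.rpow_two A, ← Real.rpow_add hA, sub_add_cancel]
      _ = _ := by
          rw [Real.mul_rpow hA.le (by positivity), ← Real.rpow_mul hD.le,
            div_mul_cancel₀ _ hp0.ne', Real.rpow_two]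

/-! ### Growth of series with slowly growing coefficients -/

theorem pow_div_factorial_le_half_pow {r : ℝ} (hr : 2 * Real.exp 1 ≤ r) {n : ℕ}
    (hn : r ^ 2 ≤ n) : r ^ n / n.factorial ≤ (1 / 2) ^ n := by
  have hr0 : 0 < r := lt_of_lt_of_le (by positivity) hr
  have h1 : (n : ℝ) ^ n / n.factorial ≤ Real.exp 1 ^ n := by
    have := Real.pow_div_factorial_le_exp (n : ℝ) (by positivity) n
    rwa [← mul_one (n : ℝ), Real.exp_nat_mul, mul_one] at this
  have h2 : (r ^ n * r ^ n) / n.factorial ≤ (r / 2) ^ n := by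
    calc (r ^ n * r ^ n) / n.factorial = (r ^ 2) ^ n / n.factorial := by
          rw [← pow_add, ← pow_mul, two_mul]
      _ ≤ (n : ℝ) ^ n / n.factorial := by gcongr
      _ ≤ Real.exp 1 ^ n := h1
      _ ≤ (r / 2) ^ n := by gcongr; linarith
  rw [mul_div_assoc, div_eq_mul_one_div r 2, mul_pow] at h2
  exact le_of_mul_le_mul_left h2 (by positivity)

/-- If the coefficients are at most `s` up to degree `r ^ 2` and at most linear afterwards, then
the degrees beyond `r ^ 2` contribute a bounded amount, and the series is dominated by `s` times
the one with constant coefficients. -/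
theorem exists_dunkl_series_growth {α : ℝ} (hα : -(1 / 2) < α) :
    ∃ K : ℝ, 0 < K ∧ ∀ᶠ r : ℝ in atTop, ∀ (x : ℕ → ℝ) (s : ℝ), 1 ≤ s → (∀ n, 0 ≤ x n) →
      (∀ n : ℕ, x n ≤ n) → (∀ n : ℕ, n ≤ r ^ 2 → x n ≤ s) →
      ∑' n, x n / dunklFactorial α n * r ^ n ≤ K * s * (Real.exp r / r ^ (α + 1 / 2)) ∧
      Summable (fun n => (x n / dunklFactorial α n * r ^ n) ^ 2) ∧
      ∑' n, (x n / dunklFactorial α n * r ^ n) ^ 2 ≤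
        (K * s * (Real.exp r / r ^ (α + 1 / 2)) * r ^ (-(1 / 4) : ℝ)) ^ 2 := by
  have hb : 0 < α + 1 / 2 := by linarith
  obtain ⟨c, hc, hcd⟩ := exists_dunklFactorial_ge hα
  obtain ⟨C₁, hC₁, h₁⟩ := exists_tsum_rpow_le hb
  obtain ⟨C₂, hC₂, h₂⟩ := exists_tsum_sq_rpow_le hb
  have hd := dunklFactorial_pos hα
  set b := α + 1 / 2 with hbdef
  have hT : Summable fun n : ℕ => (n : ℝ) * (1 / 2) ^ n := by
    simpa using summable_pow_mul_geometric_of_norm_lt_one 1 (r := (1 / 2 : ℝ)) (by norm_num)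
  set T := ∑' n : ℕ, (n : ℝ) * (1 / 2) ^ n with hTdef
  have hT0 : 0 ≤ T := tsum_nonneg fun n => by positivity
  -- Beyond such `r` the contribution `T` of the degrees above `r ^ 2` is absorbed.
  have hlarge := (tendsto_exp_div_rpow_atTop (b + 1 / 4)).eventually_ge_atTop (T + 1)
  refine ⟨C₁ / c + C₂ / c ^ 2 + 1, by positivity, ?_⟩
  filter_upwards [hlarge, eventually_ge_atTop (2 * Real.exp 1), eventually_ge_atTop 1]
    with r hrT hre hr1 x s hs hx0 hxn hxs
  have hr : 0 < r := by linarith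
  obtain ⟨hs₁, hle₁⟩ := h₁ r hr
  obtain ⟨hs₂, hle₂⟩ := h₂ r hr
  set E := Real.exp r / r ^ b with hE
  have hE0 : 0 < E := by positivity
  set D := r ^ (-(1 / 4) : ℝ) with hD
  have hD0 : 0 < D := by positivity
  have hED : T + 1 ≤ E * D := by
    rw [Real.rpow_add hr] at hrT
    rw [hE, hD, Real.rpow_neg hr.le, ← div_eq_mul_inv, div_div]
    exact hrT
  have hD1 : D ≤ 1 := Real.rpow_le_one_of_one_le_of_nonpos hr1 (by norm_num)
  have hDsq : 1 / r ^ (1 / 2 : ℝ) = D ^ 2 := by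
    rw [hD, ← Real.rpow_natCast, ← Real.rpow_mul hr.le, one_div, ← Real.rpow_neg hr.le]
    norm_num
  set y : ℕ → ℝ := fun n => r ^ n / (n.factorial * ((n : ℝ) + 1) ^ b) with hy
  have hy0 : ∀ n, 0 ≤ y n := fun n => by positivity
  have hdy : ∀ n, r ^ n / dunklFactorial α n ≤ y n / c := by
    intro n
    rw [hy, div_div, mul_comm _ c]
    exact div_le_div_of_nonneg_left (by positivity) (by positivity) (hcd n)
  have hterm0 : ∀ n, 0 ≤ x n / dunklFactorial α n * r ^ n := fun n =>
    mul_nonneg (div_nonneg (hx0 n) (hd n).le) (by positivity)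
  have hcase : ∀ n, x n / dunklFactorial α n * r ^ n ≤ s / c * y n ∨
      x n / dunklFactorial α n * r ^ n ≤ n * (1 / 2) ^ n := by
    intro n
    rcases le_total (n : ℝ) (r ^ 2) with h | h
    · left
      calc x n / dunklFactorial α n * r ^ n = x n * (r ^ n / dunklFactorial α n) := by ring
        _ ≤ s * (y n / c) :=
          mul_le_mul (hxs n h) (hdy n) (div_nonneg (by positivity) (hd n).le) (by linarith)
        _ = s / c * y n := by ring
    · right
      calc x n / dunklFactorial α n * r ^ n = x n * (r ^ n / dunklFactorial α n) := by ring
        _ ≤ n * (r ^ n / n.factorial) := by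
          refine mul_le_mul (hxn n) ?_ (div_nonneg (by positivity) (hd n).le) (by positivity)
          exact div_le_div_of_nonneg_left (by positivity) (by positivity)
            (factorial_le_dunklFactorial hα n)
        _ ≤ n * (1 / 2) ^ n := by
          gcongr
          exact pow_div_factorial_le_half_pow hre h
  have hhalf : ∀ n : ℕ, (n : ℝ) * (1 / 2) ^ n ≤ 1 := by
    intro n
    rw [one_div, inv_pow, ← div_eq_mul_inv, div_le_one₀ (by positivity)]
    exact_mod_cast (Nat.lt_two_pow_self).le
  have hsum₁ : ∀ n, x n / dunklFactorial α n * r ^ n ≤ s / c * y n + n * (1 / 2) ^ n := by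
    intro n
    have h3 : 0 ≤ s / c * y n := mul_nonneg (by positivity) (hy0 n)
    have h4 : (0 : ℝ) ≤ n * (1 / 2) ^ n := by positivity
    rcases hcase n with h | h <;> linarith
  have hsum₂ : ∀ n, (x n / dunklFactorial α n * r ^ n) ^ 2 ≤
      (s / c) ^ 2 * y n ^ 2 + n * (1 / 2) ^ n := by
    intro n
    have h4 : (0 : ℝ) ≤ n * (1 / 2) ^ n := by positivity
    rcases hcase n with h | h
    · have := pow_le_pow_left₀ (hterm0 n) h 2
      rw [mul_pow] at this
      linarith
    · have := pow_le_pow_left₀ (hterm0 n) h 2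
      have h5 : 0 ≤ (s / c) ^ 2 * y n ^ 2 := by positivity
      nlinarith [hhalf n]
  have hS₁ := (hs₁.mul_left (s / c)).add hT
  have hS₂ := (hs₂.mul_left ((s / c) ^ 2)).add hT
  have hsq := hS₂.of_nonneg_of_le (fun n => sq_nonneg _) hsum₂
  have hsE : 1 ≤ s * E * D := by nlinarith
  refine ⟨?_, hsq, ?_⟩
  · refine ((hS₁.of_nonneg_of_le hterm0 hsum₁).tsum_le_tsum hsum₁ hS₁).trans ?_
    rw [hs₁.mul_left _ |>.tsum_add hT, tsum_mul_left]
    have h6 : T ≤ s * E := by nlinarith [mul_le_mul_of_nonneg_left hD1 hE0.le]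
    calc s / c * ∑' n, y n + T ≤ s / c * (C₁ * E) + s * E := by gcongr
      _ = (C₁ / c + 0 + 1) * s * E := by ring
      _ ≤ _ := by gcongr; positivity
  · refine (hsq.tsum_le_tsum hsum₂ hS₂).trans ?_
    rw [hs₂.mul_left _ |>.tsum_add hT, tsum_mul_left]
    have h7 : T ≤ (s * E * D) ^ 2 := by
      have : T ≤ s * E * D := by nlinarith
      nlinarith
    rw [← mul_one_div (E ^ 2), hDsq] at hle₂
    calc (s / c) ^ 2 * ∑' n, y n ^ 2 + T
        ≤ (s / c) ^ 2 * (C₂ * (E ^ 2 * D ^ 2)) + (s * E * D) ^ 2 := by gcongr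
      _ = (C₂ / c ^ 2 + 1) * (s * E * D) ^ 2 := by ring
      _ ≤ (C₁ / c + C₂ / c ^ 2 + 1) ^ 2 * (s * E * D) ^ 2 := by
          gcongr
          have h8 : 0 ≤ C₁ / c := by positivity
          have h9 : 0 ≤ C₂ / c ^ 2 := by positivity
          nlinarith [mul_nonneg h8 h9]
      _ = _ := by ring

/-! ### The construction -/

theorem theorem4p4 (α : ℝ) (hα : -(1 / 2) < α) (p : ℝ≥0∞) (hp : 1 ≤ p)
    (a : ℝ) (ha : a = α + 1 / 2 + (1 / (2 * max 2 p)).toReal)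
    (φ : ℝ → ℝ) (hφ_pos : ∀ r : ℝ, 0 < r → 0 < φ r) (hφ : Tendsto φ atTop atTop) :
    ∃ f : EntireFunctions,
      IsFrequentlyHypercyclicVector (dunkl α) f ∧
      ∀ᶠ r : ℝ in atTop, integralMean p f.1 r ≤ φ r * (Real.exp r / r ^ a) := by
  obtain ⟨K, hK, hgrowth⟩ := exists_dunkl_series_growth hα
  -- The factor `2` pays for the comparison of the means of order `p < 2` with the quadratic mean.
  set P : ℕ → ℕ → Prop := fun v n =>
    v ≤ n ∧ ∀ r : ℝ, 0 < r → n ≤ r ^ 2 → (v : ℝ) ≤ φ r / (2 * K) with hPdef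
  have hP : ∀ v, ∀ᶠ n in atTop, P v n := by
    intro v
    obtain ⟨R, hR⟩ := eventually_atTop.1 (hφ.eventually_ge_atTop (v * (2 * K)))
    filter_upwards [eventually_ge_atTop v, eventually_ge_atTop ⌈R ^ 2⌉₊] with n hn hnR
    refine ⟨hn, fun r hr hnr => ?_⟩
    rw [le_div_iff₀ (by positivity)]
    exact hR r (le_of_sq_le_sq ((Nat.ceil_le.1 hnR).trans hnr) hr.le)
  have hlin : ∀ n, ‖blockCoeff P n‖ ≤ n := by
    intro n
    rcases blockCoeff_eq_zero_or P n with h | ⟨v, hv, h⟩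
    · simp [h]
    · exact h.trans (by exact_mod_cast hv.1)
  obtain ⟨f, hf⟩ := exists_entire_of_norm_le hα hlin
  refine ⟨f, isFrequentlyHypercyclicVector_of_blockCoeff hα hP hf, ?_⟩
  filter_upwards [hgrowth, eventually_gt_atTop 0, hφ.eventually_ge_atTop (2 * K)]
    with r hgr hr hφr
  have hs : 1 ≤ φ r / (2 * K) := by rwa [le_div_iff₀ (by positivity), one_mul]
  obtain ⟨hsup, hsum2, hsq⟩ := hgr (fun n => ‖blockCoeff P n‖) (φ r / (2 * K)) hs
    (fun n => norm_nonneg _) hlin fun n hn => by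
      rcases blockCoeff_eq_zero_or P n with h | ⟨v, hv, h⟩
      · rw [h, norm_zero]; linarith
      · exact h.trans (hv.2 r hr hn)
  have hKs : K * (φ r / (2 * K)) = φ r / 2 := by field_simp
  have hcn : ∀ n, ‖blockCoeff P n / (dunklFactorial α n : ℂ)‖ =
      ‖blockCoeff P n‖ / dunklFactorial α n := fun n => by
    rw [norm_div, Complex.norm_real, Real.norm_of_nonneg (dunklFactorial_pos hα n).le]
  have hφ0 := hφ_pos r hr
  set E := Real.exp r / r ^ (α + 1 / 2) with hE
  have hE0 : 0 < E := by positivity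
  set A := φ r / 2 * E with hA
  have hA0 : 0 < A := by positivity
  have hD0 : 0 < r ^ (-(1 / 4) : ℝ) := by positivity
  rw [hKs] at hsup hsq
  have hmax : ∀ z, ‖z‖ = r → ‖f.1 z‖ ≤ A := by
    intro z hz
    refine le_trans ?_ hsup
    have hsn := (hf z).summable.norm
    rw [← (hf z).tsum_eq]
    refine (norm_tsum_le_tsum_norm hsn).trans (le_of_eq (tsum_congr fun n => ?_))
    rw [norm_mul, norm_pow, hz, hcn]
  have hquad := circle_mean_sq_le hf hr.le (by simpa only [hcn] using hsum2)
  simp only [hcn] at hquad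
  have hquad' := hquad.trans hsq
  have hcont : Continuous f.1 := f.1.continuous
  have hsplit : ∀ e : ℝ, φ r * (Real.exp r / r ^ (α + 1 / 2 + e)) = 2 * A * r ^ (-e) := by
    intro e
    rw [Real.rpow_add hr, Real.rpow_neg hr.le, hA, hE]
    field_simp
  rw [ha, hsplit]
  rcases le_total p 2 with hp2 | hp2
  · have he : (1 / (2 * max 2 p)).toReal = 1 / 4 := by
      rw [max_eq_left hp2, ENNReal.toReal_div, ENNReal.toReal_mul]
      norm_num
    rw [he, mul_assoc]
    exact integralMean_le_of_le_two hp hp2 hcont (by positivity) hquad'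
  · rw [max_eq_right hp2]
    by_cases hp' : p = ∞
    · subst hp'
      have h := integralMean_top_le hA0.le hmax
      simp only [ENNReal.mul_top two_ne_zero, ENNReal.div_top, ENNReal.toReal_zero, neg_zero,
        Real.rpow_zero, mul_one]
      linarith
    · have h := integralMean_le_of_two_le hp2 hp' hcont hr.le hA0 hD0 hmax hquad'
      have he : (r ^ (-(1 / 4) : ℝ)) ^ (2 / p.toReal) = r ^ (-(1 / (2 * p)).toReal) := by
        rw [← Real.rpow_mul hr.le, ENNReal.toReal_div, ENNReal.toReal_mul]
        congr 1
        simp only [ENNReal.toReal_one, ENNReal.toReal_ofNat]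
        ring
      rw [he] at h
      refine h.trans ?_
      have : 0 ≤ A * r ^ (-(1 / (2 * p)).toReal) := by positivity
      linarith
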